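/- Let $k>0$ be real and let $f$ be a nonzero holomorphic cusp form of weight $k$ on $SL_2(\mathbb Z)$, i.e. $f$ is holomorphic on the upper half plane $\mathbb H$, $f(\tau)\to0$ as $\operatorname{Im}\tau\to\infty$, for every $\gamma=\begin{pmatrix}a&b\\c&d\end{pmatrix}\in SL_2(\mathbb Z)$ with $c>0$ there is a number $A(\gamma)$ with $|A(\gamma)|=1$ such that $f\left(\frac{a\tau+b}{c\tau+d}\right)=A(\gamma)[-i(c\tau+d)]^kf(\tau)$ for all $\tau\in\mathbb H$ (principal power), and $f(\tau)=\sum_{n\ge1}a_ne^{2\pi in\tau}$ on $\mathbb H$ with not all $a_n$ zero. For real $x$ and integers $q,h\ge1$ put $$S(x;q,h)=\sum_{\substack{1\le n\le x\\ n\equiv h\ (\mathrm{mod}\ q)}}a_n,\qquad \hat S(x;q,h)=\sum_{\substack{1\le n\le x\\ n\equiv h\ (\mathrm{mod}\ q)}}\frac{a_n}{n^{(k-1)/2}}.$$ Then for $x^{1/2+\varepsilon}\le q\le x$ one has $\hat S(x;q,h)=O(x^{1/4})$ and $S(x;q,h)=O(x^{k/2-1/4})$ for almost all $1\le h\le q$.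 Precisely: there is a constant $C>0$ depending only on $f$ such that for all $\varepsilon>0$ and $\delta>0$ there is $x_0$ such that for all real $x\ge x_0$ and all integers $q$ with $x^{1/2+\varepsilon}\le q\le x$, all but at most $\delta q$ of the integers $1\le h\le q$ satisfy both $$|\hat S(x;q,h)|\le Cx^{1/4}\quad\text{and}\quad |S(x;q,h)|\le Cx^{k/2-1/4}.$$ -/

import Mathlib

open scoped MatrixGroups Manifold

noncomputable section

/-- `f` is a nonzero holomorphic cusp form of real weight `k` on `SL(2, ℤ)`, with a multiplier of
modulus one and period one, and `a n` (`n ≥ 1`) are its Fourier coefficients at infinity.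
The value `a 0` plays no role. The power `(-i(cτ+d))^k` is the principal one; since `c > 0`,
its base has positive real part. -/
structure IsCuspFormWithCoeffs (k : ℝ) (f : UpperHalfPlane → ℂ) (a : ℕ → ℂ) : Prop where
  weight_pos : 0 < k
  holomorphic : MDifferentiable 𝓘(ℂ) 𝓘(ℂ) f
  zero_at_infty : UpperHalfPlane.IsZeroAtImInfty f
  modular : ∀ γ : SL(2, ℤ), 0 < γ 1 0 → ∃ A : ℂ, ‖A‖ = 1 ∧ ∀ τ : UpperHalfPlane,
    f (γ • τ) =
      A * (-Complex.I * (((γ 1 0 : ℤ) : ℂ) * (τ : ℂ) + ((γ 1 1 : ℤ) : ℂ))) ^ (k : ℂ) * f τ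
  fourier : ∀ τ : UpperHalfPlane,
    HasSum (fun n : ℕ+ => a n * Complex.exp (2 * Real.pi * Complex.I * (n : ℂ) * (τ : ℂ))) (f τ)
  nonzero : ∃ n : ℕ, 1 ≤ n ∧ a n ≠ 0

/-- `S(x; q, h)`: the sum of `a n` over `1 ≤ n ≤ x` with `n ≡ h (mod q)`. -/
def progressionSum (a : ℕ → ℂ) (x : ℝ) (q h : ℕ) : ℂ :=
  ∑ n ∈ (Finset.Icc 1 ⌊x⌋₊).filter (fun n => n ≡ h [MOD q]), a n

/-- The normalized coefficients `a n / n ^ ((k - 1) / 2)`. -/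
def normalizedCoeff (k : ℝ) (a : ℕ → ℂ) (n : ℕ) : ℂ :=
  a n / (((n : ℝ) ^ ((k - 1) / 2) : ℝ) : ℂ)

/-- The residues `1 ≤ h ≤ q` for which at least one of the bounds
`|Ŝ(x; q, h)| ≤ C x^(1/4)`, `|S(x; q, h)| ≤ C x^(k/2 - 1/4)` fails. -/
def exceptionalResidues (k : ℝ) (a : ℕ → ℂ) (C x : ℝ) (q : ℕ) : Finset ℕ :=
  (Finset.Icc 1 q).filter (fun h =>
    ¬ (‖progressionSum (normalizedCoeff k a) x q h‖ ≤ C * x ^ (1 / 4 : ℝ) ∧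
      ‖progressionSum a x q h‖ ≤ C * x ^ (k / 2 - 1 / 4)))

end

/-! A mean-square argument over residue classes. Hecke's bound `|f| ≪ y^(-k/2)`, integrated at
height `1/N` against a truncated geometric kernel of `L¹` norm `O(log N)`, gives `∑_{n ≤ N} a_n z^n
≪ N^(k/2) log N` uniformly in `|z| = 1` (`exists_norm_sum_le`). Partial summation turns this into
`N^(1/2) log N` for the normalized coefficients (`norm_sum_div_rpow_le`).

By Parseval for the characters of `ZMod q`, the squared sums over all classes total at most the
square of that uniform bound (`sum_norm_sq_residue_le`). Chebyshev then leaves `O(x^(1/2) log² x)`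
exceptional `h`, which is `o(q)` once `q ≥ x^(1/2+ε)`. -/

/-! ### Hecke's bound. -/

theorem IsCuspFormWithCoeffs.apply_one_vadd {k : ℝ} {f : UpperHalfPlane → ℂ} {a : ℕ → ℂ}
    (hf : IsCuspFormWithCoeffs k f a) (τ : UpperHalfPlane) : f ((1 : ℝ) +ᵥ τ) = f τ := by
  refine (hf.fourier _).unique ?_
  convert hf.fourier τ using 3 with n
  rw [UpperHalfPlane.coe_vadd, Complex.exp_eq_exp_iff_exists_int]
  exact ⟨n, by push_cast; ring⟩

/-- The function `‖f τ‖ (im τ)^(k/2)` is invariant under `SL(2, ℤ)`. -/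
theorem IsCuspFormWithCoeffs.norm_mul_im_rpow_smul {k : ℝ} {f : UpperHalfPlane → ℂ} {a : ℕ → ℂ}
    (hf : IsCuspFormWithCoeffs k f a) (g : SL(2, ℤ)) (τ : UpperHalfPlane) :
    ‖f (g • τ)‖ * (g • τ).im ^ (k / 2) = ‖f τ‖ * τ.im ^ (k / 2) := by
  have hg : g ∈ Subgroup.closure {ModularGroup.S, ModularGroup.T} := by
    simp [SpecialLinearGroup.SL2Z_generators]
  -- `modular` is needed only at `S`; `T` has `c = 0` and is covered by periodicity.
  induction hg using Subgroup.closure_induction generalizing τ with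
  | mem g hg =>
    rcases hg with rfl | rfl
    · obtain ⟨A, hA, h⟩ := hf.modular ModularGroup.S (by simp [ModularGroup.S])
      rw [h τ, norm_mul, norm_mul, hA, Complex.norm_cpow_real]
      have h1 : ‖-Complex.I * (((ModularGroup.S 1 0 : ℤ) : ℂ) * (τ : ℂ)
          + ((ModularGroup.S 1 1 : ℤ) : ℂ))‖ = ‖(τ : ℂ)‖ := by
        simp [ModularGroup.S]
      have hτ : 0 < ‖(τ : ℂ)‖ := norm_pos_iff.2 τ.ne_zero
      have h2 : (ModularGroup.S • τ).im = τ.im / ‖(τ : ℂ)‖ ^ 2 := by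
        rw [UpperHalfPlane.modular_S_smul]
        simp [Complex.inv_im, Complex.normSq_eq_norm_sq, neg_div]
      have h3 : (‖(τ : ℂ)‖ ^ 2) ^ (k / 2) = ‖(τ : ℂ)‖ ^ k := by
        rw [← Real.rpow_natCast, ← Real.rpow_mul hτ.le]
        congr 1
        push_cast
        ring
      rw [h1, h2, Real.div_rpow τ.im_pos.le (by positivity), h3]
      have := Real.rpow_pos_of_pos hτ k
      field_simp
    · rw [UpperHalfPlane.modular_T_smul, hf.apply_one_vadd, UpperHalfPlane.vadd_im]
  | one => simp
  | mul x y _ _ hx hy => rw [mul_smul, hx, hy]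
  | inv x _ hx => rw [← hx (x⁻¹ • τ), smul_inv_smul]

/-- Hecke's bound for a cusp form: `‖f τ‖ ≪ (im τ)^(-k/2)`. -/
theorem IsCuspFormWithCoeffs.exists_norm_le {k : ℝ} {f : UpperHalfPlane → ℂ} {a : ℕ → ℂ}
    (hf : IsCuspFormWithCoeffs k f a) :
    ∃ B : ℝ, 0 < B ∧ ∀ τ : UpperHalfPlane, ‖f τ‖ ≤ B * τ.im ^ (-(k / 2)) := by
  have hcont : Continuous fun τ : UpperHalfPlane => ‖f τ‖ * τ.im ^ (k / 2) :=
    hf.holomorphic.continuous.norm.mul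
      (UpperHalfPlane.continuous_im.rpow_const fun τ => .inl τ.im_ne_zero)
  have hper : Function.Periodic (f ∘ UpperHalfPlane.ofComplex) ((1 : ℝ) : ℂ) := by
    intro z
    by_cases hz : 0 < z.im
    · have hz' : 0 < (z + ((1 : ℝ) : ℂ)).im := by simpa using hz
      rw [Function.comp_apply, Function.comp_apply, UpperHalfPlane.ofComplex_apply_of_im_pos hz,
        UpperHalfPlane.ofComplex_apply_of_im_pos hz', ← hf.apply_one_vadd ⟨z, hz⟩]
      congr 1
      ext1
      simp [add_comm]
    · have hz' : (z + ((1 : ℝ) : ℂ)).im ≤ 0 := by simpa using hz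
      rw [Function.comp_apply, Function.comp_apply,
        UpperHalfPlane.ofComplex_apply_of_im_nonpos (not_lt.1 hz),
        UpperHalfPlane.ofComplex_apply_of_im_nonpos hz']
  -- Decay to zero alone would not control the growing factor `y^(k/2)`; periodicity and holomorphy
  -- upgrade it to exponential decay.
  have hdecay := hf.zero_at_infty.exp_decay_atImInfty one_pos hper hf.holomorphic
    hf.zero_at_infty.isBoundedAtImInfty
  have hbdd : UpperHalfPlane.IsBoundedAtImInfty
      fun τ : UpperHalfPlane => ‖f τ‖ * τ.im ^ (k / 2) := by
    have h1 : (fun y : ℝ => Real.exp (-2 * Real.pi * y / 1) * y ^ (k / 2)) =O[Filter.atTop]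
        (1 : ℝ → ℝ) := by
      have h := (tendsto_rpow_mul_exp_neg_mul_atTop_nhds_zero (k / 2) (2 * Real.pi)
        (by positivity)).isBigO_one ℝ
      refine h.congr_left fun y => ?_
      rw [mul_comm]
      congr 2
      ring
    exact (hdecay.norm_left.mul (Asymptotics.isBigO_refl _ _)).trans
      (h1.comp_tendsto Filter.tendsto_comap)
  obtain ⟨B, hB⟩ := ModularGroup.exists_bound_of_invariant hcont hbdd hf.norm_mul_im_rpow_smul
  refine ⟨max B 1, by positivity, fun τ => ?_⟩
  have h := (Real.le_norm_self _).trans (hB τ)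
  rw [Real.rpow_neg τ.im_pos.le, ← div_eq_mul_inv,
    le_div_iff₀ (Real.rpow_pos_of_pos τ.im_pos _)]
  exact h.trans (le_max_left _ _)

/-! ### Uniform bounds for exponential sums. -/

theorem intervalIntegral_exp_int_mul (l : ℤ) :
    ∫ t in (-(1 / 2) : ℝ)..(1 / 2), Complex.exp (2 * Real.pi * Complex.I * l * t)
      = if l = 0 then 1 else 0 := by
  split_ifs with hl
  · simp [hl]
    norm_num
  · have hc : 2 * Real.pi * Complex.I * (l : ℂ) ≠ 0 := by
      simp [hl, Real.pi_ne_zero]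
    rw [integral_exp_mul_complex hc, div_eq_zero_iff, sub_eq_zero]
    left
    rw [Complex.exp_eq_exp_iff_exists_int]
    exact ⟨l, by push_cast; ring⟩

/-- The `m`-th Fourier coefficient of `t ↦ f (α + t + iy)`. -/
theorem IsCuspFormWithCoeffs.integral_mul_exp {k : ℝ} {f : UpperHalfPlane → ℂ} {a : ℕ → ℂ}
    (hf : IsCuspFormWithCoeffs k f a) {y : ℝ} (τ : ℝ → UpperHalfPlane) (α : ℝ)
    (hτ : ∀ t, (τ t : ℂ) = α + t + y * Complex.I) {m : ℕ} (hm : 0 < m) :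
    ∫ t in (-(1 / 2) : ℝ)..(1 / 2),
        f (τ t) * Complex.exp (2 * Real.pi * y - 2 * Real.pi * Complex.I * t) ^ m
      = a m * Complex.exp (2 * Real.pi * Complex.I * α) ^ m := by
  obtain ⟨p, hp⟩ : ∃ p : ℕ+, (p : ℕ) = m := ⟨⟨m, hm⟩, rfl⟩
  have hF : ∀ (n : ℕ+) (t : ℝ),
      a n * Complex.exp (2 * Real.pi * Complex.I * (n : ℂ) * (τ t : ℂ))
        * Complex.exp (2 * Real.pi * y - 2 * Real.pi * Complex.I * t) ^ m
      = a n * Complex.exp (2 * Real.pi * Complex.I * α) ^ (n : ℕ)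
        * Complex.exp (((2 * Real.pi * y * (m - n) : ℝ) : ℂ))
        * Complex.exp (2 * Real.pi * Complex.I * ((n : ℤ) - m : ℤ) * t) := by
    intro n t
    rw [hτ, ← Complex.exp_nat_mul, ← Complex.exp_nat_mul, mul_assoc (a n), mul_assoc (a n),
      mul_assoc (a n), ← Complex.exp_add, ← Complex.exp_add, ← Complex.exp_add]
    congr 2
    push_cast
    linear_combination (-2 * Real.pi * (n : ℂ) * y) * (-Complex.I_sq)
  have hsum := intervalIntegral.hasSum_integral_of_dominated_convergence
    (μ := MeasureTheory.volume) (a := -(1 / 2)) (b := 1 / 2)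
    (F := fun (n : ℕ+) (t : ℝ) =>
      a n * Complex.exp (2 * Real.pi * Complex.I * (n : ℂ) * (τ t : ℂ))
        * Complex.exp (2 * Real.pi * y - 2 * Real.pi * Complex.I * t) ^ m)
    (f := fun t => f (τ t) * Complex.exp (2 * Real.pi * y - 2 * Real.pi * Complex.I * t) ^ m)
    (fun n _ => ‖a n‖ * Real.exp (2 * Real.pi * y * (m - n)))
    (fun n => ?_) (fun n => ?_) ?_ ?_ ?_
  · rw [hsum.unique (hasSum_single p fun n hn => ?_)]
    · simp_rw [hF, intervalIntegral.integral_const_mul, intervalIntegral_exp_int_mul, hp]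
      simp
    · have h : ((n : ℤ) - m : ℤ) ≠ 0 := by
        intro h0
        apply hn
        apply PNat.eq
        omega
      simp_rw [hF, intervalIntegral.integral_const_mul, intervalIntegral_exp_int_mul]
      rw [if_neg h, mul_zero]
  · simp_rw [hτ]
    exact Continuous.aestronglyMeasurable (by fun_prop)
  · refine .of_forall fun t _ => ?_
    rw [hF]
    have h1 : ‖Complex.exp (2 * Real.pi * Complex.I * α)‖ = 1 := by
      rw [Complex.norm_exp]
      simp
    have h2 : ‖Complex.exp (2 * Real.pi * Complex.I * ((n : ℤ) - m : ℤ) * t)‖ = 1 := by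
      rw [Complex.norm_exp]
      simp
    rw [norm_mul, norm_mul, norm_mul, norm_pow, h1, h2, ← Complex.ofReal_exp, Complex.norm_real,
      Real.norm_of_nonneg (Real.exp_pos _).le]
    simp
  -- The moduli depend only on the height `y`, so absolute convergence at `τ 0` dominates for every
  -- `t`.
  · refine .of_forall fun t _ => ?_
    have h := ((hf.fourier (τ 0)).summable.norm.mul_right (Real.exp (2 * Real.pi * y * m)))
    refine h.congr fun n => ?_
    rw [norm_mul, Complex.norm_exp, mul_assoc, ← Real.exp_add, hτ]
    congr 2
    simp
    ring
  · exact intervalIntegrable_const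
  · exact .of_forall fun t _ => (hf.fourier (τ t)).mul_right _

/-- On the unit circle the distance is `2|sin πt| ≥ 4|t|` by Jordan's inequality. Scaling `u` by `r
≥ 1` cannot decrease it: `|ru - 1|² - |u - 1|² = (r - 1)² + 2(r - 1)(1 - Re u)`. -/
theorem four_mul_abs_le_norm_exp_sub_one {y t : ℝ} (hy : 0 ≤ y) (ht : |t| ≤ 1 / 2) :
    4 * |t| ≤ ‖Complex.exp (2 * Real.pi * y - 2 * Real.pi * Complex.I * t) - 1‖ := by
  set r := Real.exp (2 * Real.pi * y)
  set u := Complex.exp (Complex.I * (-(2 * Real.pi * t) : ℝ)) with hu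
  have hr : 1 ≤ r := Real.one_le_exp (by positivity)
  have hw : Complex.exp (2 * Real.pi * y - 2 * Real.pi * Complex.I * t) = r * u := by
    rw [hu, Complex.ofReal_exp, ← Complex.exp_add]
    congr 1
    push_cast
    ring
  have hu1 : ‖u‖ = 1 := by
    rw [hu, mul_comm]
    exact Complex.norm_exp_ofReal_mul_I _
  have h1 : 4 * |t| ≤ ‖u - 1‖ := by
    rw [hu, Complex.norm_exp_I_mul_ofReal_sub_one, norm_mul, Real.norm_eq_abs (Real.sin _)]
    have h := Real.mul_abs_le_abs_sin (x := -(2 * Real.pi * t) / 2) (by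
      rw [abs_div, abs_neg, abs_mul, abs_of_pos Real.two_pi_pos, abs_two]
      nlinarith [Real.pi_pos])
    rw [abs_div, abs_neg, abs_mul, abs_of_pos Real.two_pi_pos, abs_two] at h
    have h' : 2 / Real.pi * (2 * Real.pi * |t| / 2) = 2 * |t| := by
      field_simp
    rw [h'] at h
    norm_num
    linarith
  have h2 : ‖u - 1‖ ≤ ‖r * u - 1‖ := by
    have hsq : u.re ^ 2 + u.im ^ 2 = 1 := by
      have := Complex.sq_norm u
      rw [hu1, Complex.normSq_apply] at this
      linarith
    have hre : u.re ≤ 1 := (Complex.re_le_norm u).trans hu1.le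
    refine le_of_sq_le_sq ?_ (norm_nonneg _)
    rw [Complex.sq_norm, Complex.sq_norm, Complex.normSq_apply, Complex.normSq_apply]
    simp
    nlinarith [mul_nonneg (sub_nonneg.2 hr) (sub_nonneg.2 hre),
      mul_nonneg (sub_nonneg.2 hr) (sub_nonneg.2 hr)]
  rw [hw]
  exact h1.trans h2

/-- A bound for the truncated geometric kernel. -/
theorem norm_sum_exp_pow_le {N : ℕ} (hN : 1 ≤ N) {t : ℝ} (ht : |t| ≤ 1 / 2) :
    ‖∑ m ∈ Finset.Icc 1 N,
        Complex.exp (2 * Real.pi * ((1 / N : ℝ) : ℂ) - 2 * Real.pi * Complex.I * t) ^ m‖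
      ≤ 2 * Real.exp (2 * Real.pi) * (Real.exp (2 * Real.pi) + 1) * (N / (1 + N * |t|)) := by
  have hN0 : (0 : ℝ) < N := by exact_mod_cast hN
  set E := Real.exp (2 * Real.pi)
  have hE : 1 ≤ E := Real.one_le_exp (by positivity)
  set w := Complex.exp (2 * Real.pi * ((1 / N : ℝ) : ℂ) - 2 * Real.pi * Complex.I * t) with hw
  have hwn : ‖w‖ = Real.exp (2 * Real.pi * (1 / N)) := by
    rw [hw, Complex.norm_exp]
    congr 1
    simp
  -- Height `1/N` keeps all powers up to `N` bounded by a constant.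
  have hwN : ‖w‖ ^ N = E := by
    rw [hwn, ← Real.exp_nat_mul]
    congr 1
    field_simp
  have hw1 : 1 ≤ ‖w‖ := by
    rw [hwn]
    exact Real.one_le_exp (by positivity)
  have hpow : ∀ m ≤ N, ‖w‖ ^ m ≤ E := fun m hm => hwN ▸ pow_le_pow_right₀ hw1 hm
  have hden : 0 < 1 + N * |t| := by positivity
  rw [← mul_div_assoc, le_div_iff₀ hden]
  set D := ∑ m ∈ Finset.Icc 1 N, w ^ m with hD
  have hD1 : ‖D‖ ≤ E * N := by
    refine (norm_sum_le_of_le (f := fun m => w ^ m) (n := fun _ => E) _ fun m hm => ?_).trans_eq ?_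
    · rw [norm_pow]
      exact hpow m (Finset.mem_Icc.1 hm).2
    · simp [mul_comm]
  have hD2 : ‖D‖ * |t| ≤ E * (E + 1) := by
    have hgeom : D * (w - 1) = w * (w ^ N - 1) := by
      rw [← geom_sum_mul, hD, ← mul_assoc, Finset.mul_sum, ← Finset.Ico_add_one_right_eq_Icc,
        Finset.sum_Ico_eq_sum_range]
      congr 1
      refine Finset.sum_congr (by simp) fun i _ => ?_
      rw [pow_add, pow_one]
    have h := congrArg norm hgeom
    rw [norm_mul, norm_mul] at h
    have h3 : ‖w ^ N - 1‖ ≤ E + 1 := by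
      refine (norm_sub_le _ _).trans ?_
      rw [norm_pow, hwN, norm_one]
    have h4 : ‖w‖ ≤ E := by simpa using hpow 1 hN
    have h5 : ‖w‖ * ‖w ^ N - 1‖ ≤ E * (E + 1) := by gcongr
    have h6 := mul_le_mul_of_nonneg_left
      (four_mul_abs_le_norm_exp_sub_one (y := 1 / N) (by positivity) ht) (norm_nonneg D)
    nlinarith [mul_nonneg (norm_nonneg D) (abs_nonneg t)]
  -- The trivial and geometric bounds add up to `E(E + 2)N ≤ 2E(E + 1)N`.
  nlinarith [mul_le_mul_of_nonneg_left hD2 hN0.le, mul_nonneg (by positivity : 0 ≤ E * E) hN0.le]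

/-- The source of the logarithm in the exponential sum bound. -/
theorem integral_div_one_add_mul_abs (N : ℕ) :
    ∫ t in (-(1 / 2) : ℝ)..(1 / 2), (N : ℝ) / (1 + N * |t|) = 2 * Real.log (1 + N / 2) := by
  have hcont : Continuous fun t : ℝ => (N : ℝ) / (1 + N * |t|) :=
    continuous_const.div (by fun_prop) fun t => by positivity
  have hpos : ∫ t in (0 : ℝ)..(1 / 2), (N : ℝ) / (1 + N * |t|) = Real.log (1 + N / 2) := by
    have hderiv : ∀ t ∈ Set.uIcc (0 : ℝ) (1 / 2),
        HasDerivAt (fun t : ℝ => Real.log (1 + N * t)) ((N : ℝ) / (1 + N * |t|)) t := by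
      intro t ht
      rw [Set.uIcc_of_le (by norm_num)] at ht
      have ht0 : 0 ≤ t := ht.1
      rw [abs_of_nonneg ht0]
      have h : HasDerivAt (fun t : ℝ => 1 + N * t) (N : ℝ) t := by
        simpa using ((hasDerivAt_id t).const_mul (N : ℝ)).const_add 1
      exact h.log (by positivity)
    rw [intervalIntegral.integral_eq_sub_of_hasDerivAt hderiv (hcont.intervalIntegrable _ _)]
    simp [div_eq_mul_inv]
  have hneg : ∫ t in (-(1 / 2) : ℝ)..0, (N : ℝ) / (1 + N * |t|)
      = ∫ t in (0 : ℝ)..(1 / 2), (N : ℝ) / (1 + N * |t|) := by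
    have h := intervalIntegral.integral_comp_neg (a := 0) (b := 1 / 2)
      (fun t : ℝ => (N : ℝ) / (1 + N * |t|))
    simp only [abs_neg, neg_zero] at h
    exact h.symm
  rw [← intervalIntegral.integral_add_adjacent_intervals (hcont.intervalIntegrable _ 0)
    (hcont.intervalIntegrable _ _), hneg, hpos]
  ring

/-- The exponential sums of the coefficients of a cusp form are `≪ N^(k/2) log N`, uniformly in the
frequency. -/
theorem IsCuspFormWithCoeffs.exists_norm_sum_le {k : ℝ} {f : UpperHalfPlane → ℂ} {a : ℕ → ℂ}
    (hf : IsCuspFormWithCoeffs k f a) :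
    ∃ K : ℝ, 0 < K ∧ ∀ (N : ℕ), 1 ≤ N → ∀ z : ℂ, ‖z‖ = 1 →
      ‖∑ n ∈ Finset.Icc 1 N, a n * z ^ n‖ ≤ K * (N : ℝ) ^ (k / 2) * Real.log (1 + N) := by
  obtain ⟨B, hB, hbound⟩ := hf.exists_norm_le
  set P := 2 * Real.exp (2 * Real.pi) * (Real.exp (2 * Real.pi) + 1) with hP
  have hP0 : 0 < P := by positivity
  refine ⟨B * P * 2, by positivity, fun N hN z hz => ?_⟩
  have hN0 : (0 : ℝ) < N := by exact_mod_cast hN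
  set α : ℝ := Complex.arg z / (2 * Real.pi) with hα
  have hz' : z = Complex.exp (2 * Real.pi * Complex.I * α) := by
    conv_lhs => rw [← Complex.norm_mul_exp_arg_mul_I z, hz, Complex.ofReal_one, one_mul]
    congr 1
    rw [hα]
    push_cast
    have : (Real.pi : ℂ) ≠ 0 := by exact_mod_cast Real.pi_ne_zero
    field_simp
  let τ : ℝ → UpperHalfPlane := fun t => ⟨α + t + ((1 / N : ℝ) : ℂ) * Complex.I, by
    simpa using Nat.lt_of_succ_le hN⟩
  have hτ : ∀ t, (τ t : ℂ) = α + t + ((1 / N : ℝ) : ℂ) * Complex.I := fun t => rfl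
  have hτc : Continuous τ := by
    rw [UpperHalfPlane.isEmbedding_coe.continuous_iff]
    exact (by fun_prop : Continuous fun t : ℝ => (α : ℂ) + t + ((1 / N : ℝ) : ℂ) * Complex.I)
  have hfc : Continuous fun t => f (τ t) := hf.holomorphic.continuous.comp hτc
  have him : ∀ t, (τ t).im = 1 / N := fun t => by
    rw [← UpperHalfPlane.coe_im, hτ]
    simp
  have hcoeff : ∑ n ∈ Finset.Icc 1 N, a n * z ^ n
      = ∫ t in (-(1 / 2) : ℝ)..(1 / 2), f (τ t) * ∑ m ∈ Finset.Icc 1 N,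
          Complex.exp (2 * Real.pi * ((1 / N : ℝ) : ℂ) - 2 * Real.pi * Complex.I * t) ^ m := by
    simp_rw [Finset.mul_sum]
    have hterm : ∀ m : ℕ, Continuous fun t : ℝ => f (τ t) *
        Complex.exp (2 * Real.pi * ((1 / N : ℝ) : ℂ) - 2 * Real.pi * Complex.I * t) ^ m :=
      fun m => hfc.mul (by fun_prop)
    rw [intervalIntegral.integral_finsetSum fun m _ => (hterm m).intervalIntegrable _ _]
    refine Finset.sum_congr rfl fun m hm => ?_
    rw [hf.integral_mul_exp τ α hτ (Finset.mem_Icc.1 hm).1, hz']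
  have hcont : Continuous fun t : ℝ => (N : ℝ) / (1 + N * |t|) :=
    continuous_const.div (by fun_prop) fun t => by positivity
  have hlog : Real.log (1 + (N : ℝ) / 2) ≤ Real.log (1 + N) :=
    Real.log_le_log (by positivity) (by linarith)
  have hle : ‖∑ n ∈ Finset.Icc 1 N, a n * z ^ n‖ ≤ ∫ t in (-(1 / 2) : ℝ)..(1 / 2),
      B * (N : ℝ) ^ (k / 2) * P * ((N : ℝ) / (1 + N * |t|)) := by
    rw [hcoeff]
    refine intervalIntegral.norm_integral_le_of_norm_le (by norm_num)
      (.of_forall fun t ht => ?_) ((continuous_const.mul hcont).intervalIntegrable _ _)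
    have ht' : |t| ≤ 1 / 2 := abs_le.2 ⟨ht.1.le, ht.2⟩
    have hft : ‖f (τ t)‖ ≤ B * (N : ℝ) ^ (k / 2) := by
      refine (hbound (τ t)).trans_eq ?_
      rw [him, one_div, Real.inv_rpow hN0.le, Real.rpow_neg hN0.le, inv_inv]
    rw [norm_mul, mul_assoc (B * (N : ℝ) ^ (k / 2))]
    exact mul_le_mul hft (norm_sum_exp_pow_le hN ht') (norm_nonneg _) (by positivity)
  refine hle.trans ?_
  rw [intervalIntegral.integral_const_mul, integral_div_one_add_mul_abs]
  calc B * (N : ℝ) ^ (k / 2) * P * (2 * Real.log (1 + N / 2))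
      ≤ B * (N : ℝ) ^ (k / 2) * P * (2 * Real.log (1 + N)) := by gcongr
    _ = B * P * 2 * (N : ℝ) ^ (k / 2) * Real.log (1 + N) := by ring

/-! ### Parseval over residue classes. -/

/-- If the exponential sums of `b` over `[1, N]` are bounded by `M`, then so is the `ℓ²` norm of
its sums over the residue classes modulo `q`. -/
theorem sum_norm_sq_residue_le {b : ℕ → ℂ} {N q : ℕ} (hq : 0 < q) {M : ℝ}
    (hM : ∀ z : ℂ, ‖z‖ = 1 → ‖∑ n ∈ Finset.Icc 1 N, b n * z ^ n‖ ≤ M) :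
    ∑ h ∈ Finset.Icc 1 q, ‖∑ n ∈ (Finset.Icc 1 N).filter (fun n => n ≡ h [MOD q]), b n‖ ^ 2
      ≤ M ^ 2 := by
  classical
  have : NeZero q := ⟨hq.ne'⟩
  set F : ZMod q → ℂ :=
    fun r => ∑ n ∈ (Finset.Icc 1 N).filter (fun n : ℕ => (n : ZMod q) = r), b n with hF
  have hsum : ∑ h ∈ Finset.Icc 1 q,
      ‖∑ n ∈ (Finset.Icc 1 N).filter (fun n => n ≡ h [MOD q]), b n‖ ^ 2 = ∑ r, ‖F r‖ ^ 2 := by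
    refine Finset.sum_bij (fun h _ => (h : ZMod q)) (fun _ _ => Finset.mem_univ _) ?_ ?_ ?_
    · intro h₁ hh₁ h₂ hh₂ h
      rw [ZMod.natCast_eq_natCast_iff] at h
      rw [Finset.mem_Icc] at hh₁ hh₂
      have h' : h₁ - 1 ≡ h₂ - 1 [MOD q] := by
        apply Nat.ModEq.add_right_cancel' 1
        rwa [Nat.sub_add_cancel hh₁.1, Nat.sub_add_cancel hh₂.1]
      have := h'.eq_of_lt_of_lt (by omega) (by omega)
      omega
    · intro r _
      by_cases hr : r = 0
      -- The zero class is represented by `h = q`.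
      · exact ⟨q, Finset.mem_Icc.2 ⟨hq, le_rfl⟩, by simp [hr]⟩
      · refine ⟨r.val, Finset.mem_Icc.2 ⟨?_, r.val_lt.le⟩, by simp⟩
        exact Nat.one_le_iff_ne_zero.2 ((ZMod.val_ne_zero r).2 hr)
    · intro h _
      simp only [hF, ZMod.natCast_eq_natCast_iff]
  -- A character transform of `F` is the exponential sum at `z = ψ 1`, a point of the unit circle.
  have hchar : ∀ ψ : AddChar (ZMod q) ℂ,
      ∑ r, F r * ψ r = ∑ n ∈ Finset.Icc 1 N, b n * ψ 1 ^ n := by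
    intro ψ
    rw [← Finset.sum_fiberwise (Finset.Icc 1 N) (fun n : ℕ => (n : ZMod q))
      (fun n => b n * ψ 1 ^ n)]
    refine Finset.sum_congr rfl fun r _ => ?_
    rw [hF, Finset.sum_mul]
    refine Finset.sum_congr rfl fun n hn => ?_
    rw [← (Finset.mem_filter.1 hn).2, ← AddChar.map_nsmul_eq_pow, nsmul_one]
  have hparseval : ∑ ψ : AddChar (ZMod q) ℂ, ‖∑ r, F r * ψ r‖ ^ 2 = q * ∑ r, ‖F r‖ ^ 2 := by
    have : ((∑ ψ : AddChar (ZMod q) ℂ, ‖∑ r, F r * ψ r‖ ^ 2 : ℝ) : ℂ)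
        = ((q * ∑ r, ‖F r‖ ^ 2 : ℝ) : ℂ) := by
      push_cast
      simp_rw [← Complex.mul_conj', map_sum, map_mul, Finset.sum_mul_sum]
      rw [Finset.sum_comm, Finset.mul_sum]
      refine Finset.sum_congr rfl fun r _ => ?_
      rw [Finset.sum_comm, Finset.sum_eq_single r]
      · have : ∀ ψ : AddChar (ZMod q) ℂ,
            F r * ψ r * ((starRingEnd ℂ) (F r) * (starRingEnd ℂ) (ψ r))
              = F r * (starRingEnd ℂ) (F r) := by
          intro ψ
          have h : ψ r * (starRingEnd ℂ) (ψ r) = 1 := by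
            rw [Complex.mul_conj']
            simp
          linear_combination F r * (starRingEnd ℂ) (F r) * h
        simp [this, AddChar.card_eq]
      · intro s _ hs
        have : ∀ ψ : AddChar (ZMod q) ℂ,
            F r * ψ r * ((starRingEnd ℂ) (F s) * (starRingEnd ℂ) (ψ s))
              = F r * (starRingEnd ℂ) (F s) * ψ (r - s) := by
          intro ψ
          rw [sub_eq_add_neg, AddChar.map_add_eq_mul, AddChar.map_neg_eq_conj]
          ring
        simp_rw [this, ← Finset.mul_sum, AddChar.sum_apply_eq_ite,
          if_neg (sub_ne_zero.2 hs.symm), mul_zero]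
      · simp
    exact_mod_cast this
  have hle : ∑ ψ : AddChar (ZMod q) ℂ, ‖∑ r, F r * ψ r‖ ^ 2 ≤ q * M ^ 2 := by
    calc _ ≤ ∑ _ψ : AddChar (ZMod q) ℂ, M ^ 2 := by
          refine Finset.sum_le_sum fun ψ _ => ?_
          rw [hchar]
          exact pow_le_pow_left₀ (norm_nonneg _) (hM _ (by simp)) 2
      _ = q * M ^ 2 := by simp [AddChar.card_eq]
  rw [hparseval] at hle
  rw [hsum]
  exact le_of_mul_le_mul_left hle (by exact_mod_cast hq)

/-! ### Partial summation. -/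

theorem sum_Icc_inv_sqrt_le (N : ℕ) :
    ∑ n ∈ Finset.Icc 1 N, (n : ℝ) ^ (-(1 / 2) : ℝ) ≤ 2 * (N : ℝ) ^ (1 / 2 : ℝ) := by
  induction N with
  | zero => simp
  | succ N ih =>
    rw [Finset.sum_Icc_succ_top (by omega)]
    refine (add_le_add_left ih _).trans ?_
    rw [Real.rpow_neg (by positivity), ← Real.sqrt_eq_rpow, ← Real.sqrt_eq_rpow]
    set s := Real.sqrt (N : ℝ)
    set t := Real.sqrt ((N + 1 : ℕ) : ℝ)
    have ht : 0 < t := Real.sqrt_pos.2 (by positivity)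
    have hs2 : s ^ 2 = N := Real.sq_sqrt (by positivity)
    have ht2 : t ^ 2 = N + 1 := by
      rw [Real.sq_sqrt (by positivity)]
      push_cast
      ring
    have h : t⁻¹ * t = 1 := inv_mul_cancel₀ ht.ne'
    -- Since `s² = t² - 1`, this expands to `1/t ≤ 2(t - s)`.
    have : 0 ≤ t⁻¹ * (t - s) ^ 2 := by positivity
    nlinarith

/-- Mean value inequality: for `β ≤ 1` the derivative is largest in modulus at the left endpoint. It
is applied with `β = (1 - k)/2`. -/
theorem abs_rpow_add_one_sub_le {β : ℝ} (hβ : β ≤ 1) {n : ℝ} (hn : 0 < n) :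
    |(n + 1) ^ β - n ^ β| ≤ |β| * n ^ (β - 1) := by
  have h := Convex.norm_image_sub_le_of_norm_deriv_le (f := fun t : ℝ => t ^ β)
    (C := |β| * n ^ (β - 1)) (s := Set.Icc n (n + 1)) (x := n) (y := n + 1)
    (fun t ht => Real.differentiableAt_rpow_const_of_ne β (hn.trans_le ht.1).ne')
    (fun t ht => ?_) (convex_Icc _ _) ⟨le_rfl, by linarith⟩ ⟨by linarith, le_rfl⟩
  · simpa using h
  · have ht0 := hn.trans_le ht.1
    rw [Real.deriv_rpow_const, Real.norm_eq_abs, abs_mul,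
      abs_of_pos (Real.rpow_pos_of_pos ht0 _)]
    exact mul_le_mul_of_nonneg_left
      (Real.rpow_le_rpow_of_nonpos hn ht.1 (by linarith)) (abs_nonneg _)

/-- Partial summation: a bound for the sums of `c` gives one for the sums of `c n / n^((k-1)/2)`. -/
theorem norm_sum_div_rpow_le {k K : ℝ} (hk : 0 < k) (hK : 0 ≤ K) {c : ℕ → ℂ}
    (hc : ∀ N : ℕ, 1 ≤ N →
      ‖∑ n ∈ Finset.Icc 1 N, c n‖ ≤ K * (N : ℝ) ^ (k / 2) * Real.log (1 + N))
    (N : ℕ) (hN : 1 ≤ N) :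
    ‖∑ n ∈ Finset.Icc 1 N, c n / (((n : ℝ) ^ ((k - 1) / 2) : ℝ) : ℂ)‖
      ≤ (1 + |k - 1|) * K * (N : ℝ) ^ (1 / 2 : ℝ) * Real.log (1 + N) := by
  set w : ℕ → ℝ := fun n => (n : ℝ) ^ (-((k - 1) / 2))
  set G : ℕ → ℂ := fun m => ∑ n ∈ Finset.Icc 1 m, c n with hG
  have hparts : ∀ N, ∑ n ∈ Finset.Icc 1 N, c n / (((n : ℝ) ^ ((k - 1) / 2) : ℝ) : ℂ)
      = (w N : ℂ) * G N - ∑ n ∈ Finset.Ico 1 N, ((w (n + 1) - w n : ℝ) : ℂ) * G n := by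
    intro N
    induction N with
    | zero => simp [hG]
    | succ N ih =>
      have hw : c (N + 1) / ((((N + 1 : ℕ) : ℝ) ^ ((k - 1) / 2) : ℝ) : ℂ)
          = (w (N + 1) : ℂ) * c (N + 1) := by
        simp only [w]
        rw [Real.rpow_neg (by positivity), Complex.ofReal_inv, div_eq_inv_mul]
      have hG1 : G (N + 1) = G N + c (N + 1) := Finset.sum_Icc_succ_top (by omega) _
      rw [Finset.sum_Icc_succ_top (by omega), ih, hw, hG1]
      rcases Nat.eq_zero_or_pos N with rfl | hN
      · simp [hG]
      · rw [Finset.sum_Ico_succ_top hN]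
        push_cast
        ring
  have hlog : 0 ≤ Real.log (1 + N) := Real.log_nonneg (by linarith [Nat.cast_nonneg (α := ℝ) N])
  have hN0 : (0 : ℝ) < N := by exact_mod_cast hN
  rw [hparts]
  have h1 : ‖(w N : ℂ) * G N‖ ≤ K * (N : ℝ) ^ (1 / 2 : ℝ) * Real.log (1 + N) := by
    have hw : 0 < w N := Real.rpow_pos_of_pos hN0 _
    rw [norm_mul, Complex.norm_real, Real.norm_of_nonneg hw.le]
    refine (mul_le_mul_of_nonneg_left (hc N hN) hw.le).trans_eq ?_
    have : (N : ℝ) ^ (1 / 2 : ℝ) = w N * (N : ℝ) ^ (k / 2) := by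
      rw [← Real.rpow_add hN0]
      congr 1
      ring
    rw [this]
    ring
  have h2 : ‖∑ n ∈ Finset.Ico 1 N, ((w (n + 1) - w n : ℝ) : ℂ) * G n‖
      ≤ |k - 1| * K * (N : ℝ) ^ (1 / 2 : ℝ) * Real.log (1 + N) := by
    have hterm : ∀ n ∈ Finset.Ico 1 N, ‖((w (n + 1) - w n : ℝ) : ℂ) * G n‖
        ≤ |k - 1| / 2 * K * Real.log (1 + N) * (n : ℝ) ^ (-(1 / 2) : ℝ) := by
      intro n hn
      rw [Finset.mem_Ico] at hn
      have hn0 : (0 : ℝ) < n := by exact_mod_cast hn.1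
      have hnN : (n : ℝ) ≤ N := by exact_mod_cast hn.2.le
      have hwd : |w (n + 1) - w n| ≤ |k - 1| / 2 * (n : ℝ) ^ (-((k - 1) / 2) - 1) := by
        have h := abs_rpow_add_one_sub_le (β := -((k - 1) / 2)) (by linarith) hn0
        rw [abs_neg, abs_div, abs_two] at h
        simpa [w] using h
      rw [norm_mul, Complex.norm_real, Real.norm_eq_abs]
      have hGn : ‖G n‖ ≤ K * (n : ℝ) ^ (k / 2) * Real.log (1 + N) := by
        refine (hc n hn.1).trans ?_
        gcongr
      refine (mul_le_mul hwd hGn (norm_nonneg _) (by positivity)).trans_eq ?_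
      have : (n : ℝ) ^ (-(1 / 2) : ℝ) = (n : ℝ) ^ (-((k - 1) / 2) - 1) * (n : ℝ) ^ (k / 2) := by
        rw [← Real.rpow_add hn0]
        congr 1
        ring
      rw [this]
      ring
    refine (norm_sum_le_of_le _ hterm).trans ?_
    rw [← Finset.mul_sum]
    have hs : ∑ n ∈ Finset.Ico 1 N, (n : ℝ) ^ (-(1 / 2) : ℝ) ≤ 2 * (N : ℝ) ^ (1 / 2 : ℝ) :=
      (Finset.sum_le_sum_of_subset_of_nonneg Finset.Ico_subset_Icc_self
        fun n _ _ => by positivity).trans (sum_Icc_inv_sqrt_le N)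
    refine (mul_le_mul_of_nonneg_left hs (by positivity)).trans_eq ?_
    ring
  refine (norm_sub_le _ _).trans ((add_le_add h1 h2).trans_eq ?_)
  ring

/-! ### Counting exceptional residues. -/

/-- Chebyshev's inequality for the sums over residue classes. -/
theorem card_filter_lt_norm_mul_sq_le {b : ℕ → ℂ} {x : ℝ} {q : ℕ} (hq : 0 < q) {M R : ℝ}
    (hR : 0 ≤ R)
    (hM : ∀ z : ℂ, ‖z‖ = 1 → ‖∑ n ∈ Finset.Icc 1 ⌊x⌋₊, b n * z ^ n‖ ≤ M) :
    (((Finset.Icc 1 q).filter fun h => R < ‖progressionSum b x q h‖).card : ℝ) * R ^ 2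
      ≤ M ^ 2 := by
  refine le_trans ?_ (sum_norm_sq_residue_le hq hM)
  rw [← nsmul_eq_mul]
  refine (Finset.card_nsmul_le_sum _ (fun h => ‖progressionSum b x q h‖ ^ 2) _ fun h hh => ?_).trans
    (Finset.sum_le_sum_of_subset_of_nonneg (Finset.filter_subset _ _) fun _ _ _ => by positivity)
  exact pow_le_pow_left₀ hR (Finset.mem_filter.1 hh).2.le 2

theorem eventually_mul_log_sq_le_rpow {c ε : ℝ} (hc : 0 < c) (hε : 0 < ε) :
    ∀ᶠ x : ℝ in Filter.atTop, c * Real.log (1 + x) ^ 2 ≤ x ^ ε := by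
  have hlittle := (isLittleO_log_rpow_atTop (half_pos hε)).def
    (inv_pos.2 (mul_pos two_pos (Real.sqrt_pos.2 hc)))
  filter_upwards [hlittle, Filter.eventually_ge_atTop 2] with x hx hx2
  have hlog : 0 ≤ Real.log x := Real.log_nonneg (by linarith)
  have hp : 0 ≤ x ^ (ε / 2) := by positivity
  rw [Real.norm_of_nonneg hlog, Real.norm_of_nonneg hp, ← div_eq_inv_mul,
    le_div_iff₀ (by positivity)] at hx
  have h1 : Real.log (1 + x) ≤ 2 * Real.log x := by
    rw [← Real.log_rpow (by linarith)]
    refine Real.log_le_log (by linarith) ?_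
    norm_num
    nlinarith
  have h0 : 0 ≤ Real.log (1 + x) := Real.log_nonneg (by linarith)
  calc c * Real.log (1 + x) ^ 2 = (Real.sqrt c * Real.log (1 + x)) ^ 2 := by
        rw [mul_pow, Real.sq_sqrt hc.le]
    _ ≤ (x ^ (ε / 2)) ^ 2 := by
        refine pow_le_pow_left₀ (by positivity) ?_ 2
        nlinarith [mul_le_mul_of_nonneg_left h1 (Real.sqrt_nonneg c)]
    _ = x ^ ε := by
        rw [← Real.rpow_natCast, ← Real.rpow_mul (by linarith)]
        congr 1
        push_cast
        ring

/-- A bound `K N^(s + 1/4) log N` for exponential sums gives a bound for the number of residue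
classes over which the sum exceeds `x^s`. -/
theorem card_filter_rpow_lt_norm_le {b : ℕ → ℂ} {K s : ℝ} (hK : 0 ≤ K) (hs : 0 ≤ s + 1 / 4)
    (hb : ∀ N : ℕ, 1 ≤ N → ∀ z : ℂ, ‖z‖ = 1 →
      ‖∑ n ∈ Finset.Icc 1 N, b n * z ^ n‖ ≤ K * (N : ℝ) ^ (s + 1 / 4) * Real.log (1 + N))
    {x : ℝ} (hx : 1 ≤ x) {q : ℕ} (hq : 0 < q) :
    (((Finset.Icc 1 q).filter fun h => x ^ s < ‖progressionSum b x q h‖).card : ℝ)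
      ≤ K ^ 2 * Real.log (1 + x) ^ 2 * x ^ (1 / 2 : ℝ) := by
  have hx0 : 0 < x := by linarith
  have hfloor : ((⌊x⌋₊ : ℕ) : ℝ) ≤ x := Nat.floor_le hx0.le
  have hlog : 0 ≤ Real.log (1 + x) := Real.log_nonneg (by linarith)
  have h := card_filter_lt_norm_mul_sq_le (b := b) (x := x) hq (Real.rpow_pos_of_pos hx0 s).le
    (M := K * x ^ (s + 1 / 4) * Real.log (1 + x)) fun z hz => by
      refine (hb ⌊x⌋₊ (Nat.le_floor (by simpa using hx)) z hz).trans ?_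
      gcongr
      exact Real.log_nonneg (by linarith [Nat.cast_nonneg (α := ℝ) ⌊x⌋₊])
  have hR : 0 < (x ^ s) ^ 2 := by positivity
  refine le_of_mul_le_mul_right (h.trans_eq ?_) hR
  rw [Real.rpow_add hx0]
  have : x ^ (1 / 2 : ℝ) = (x ^ (1 / 4 : ℝ)) ^ 2 := by
    rw [← Real.rpow_natCast, ← Real.rpow_mul hx0.le]
    norm_num
  rw [this]
  ring

theorem mainTheorem9 (k : ℝ) (f : UpperHalfPlane → ℂ) (a : ℕ → ℂ)
    (hf : IsCuspFormWithCoeffs k f a) :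
    ∃ C : ℝ, 0 < C ∧ ∀ ε : ℝ, 0 < ε → ∀ δ : ℝ, 0 < δ →
      ∃ x₀ : ℝ, ∀ x : ℝ, x₀ ≤ x → ∀ q : ℕ, x ^ (1 / 2 + ε) ≤ (q : ℝ) → (q : ℝ) ≤ x →
        ((exceptionalResidues k a C x q).card : ℝ) ≤ δ * (q : ℝ) := by
  obtain ⟨K, hK, ha⟩ := hf.exists_norm_sum_le
  have hk := hf.weight_pos
  set K' := (1 + |k - 1|) * K with hK'
  have hK'0 : 0 < K' := by positivity
  have hnorm : ∀ N : ℕ, 1 ≤ N → ∀ z : ℂ, ‖z‖ = 1 →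
      ‖∑ n ∈ Finset.Icc 1 N, normalizedCoeff k a n * z ^ n‖
        ≤ K' * (N : ℝ) ^ (1 / 4 + 1 / 4 : ℝ) * Real.log (1 + N) := by
    intro N hN z hz
    have h := norm_sum_div_rpow_le hk hK.le (fun N hN => ha N hN z hz) N hN
    rw [show (1 / 4 + 1 / 4 : ℝ) = 1 / 2 by norm_num]
    simpa only [normalizedCoeff, div_mul_eq_mul_div] using h
  have ha' : ∀ N : ℕ, 1 ≤ N → ∀ z : ℂ, ‖z‖ = 1 →
      ‖∑ n ∈ Finset.Icc 1 N, a n * z ^ n‖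
        ≤ K * (N : ℝ) ^ (k / 2 - 1 / 4 + 1 / 4) * Real.log (1 + N) := by
    intro N hN z hz
    rw [sub_add_cancel]
    exact ha N hN z hz
  -- `C = 1` suffices: `x^ε` absorbs the logarithms, `1/δ` and the constants of `f`.
  refine ⟨1, one_pos, fun ε hε δ hδ => ?_⟩
  obtain ⟨x₁, hx₁⟩ := Filter.eventually_atTop.1 (eventually_mul_log_sq_le_rpow
    (c := (K' ^ 2 + K ^ 2) / δ) (by positivity) hε)
  refine ⟨max x₁ 1, fun x hx q hq _ => ?_⟩
  have hx1 : 1 ≤ x := (le_max_right _ _).trans hx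
  have hx0 : 0 < x := by linarith
  have hq0 : 0 < q := by
    have : (0 : ℝ) < q := (Real.rpow_pos_of_pos hx0 _).trans_le hq
    exact_mod_cast this
  have hsub : exceptionalResidues k a 1 x q ⊆
      ((Finset.Icc 1 q).filter fun h =>
        x ^ (1 / 4 : ℝ) < ‖progressionSum (normalizedCoeff k a) x q h‖) ∪
      ((Finset.Icc 1 q).filter fun h => x ^ (k / 2 - 1 / 4) < ‖progressionSum a x q h‖) := by
    intro h hh
    rw [exceptionalResidues, Finset.mem_filter, not_and_or, not_le, not_le, one_mul, one_mul] at hh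
    rw [Finset.mem_union, Finset.mem_filter, Finset.mem_filter]
    tauto
  have hlarge := hx₁ x ((le_max_left _ _).trans hx)
  rw [div_mul_eq_mul_div, div_le_iff₀ hδ] at hlarge
  calc ((exceptionalResidues k a 1 x q).card : ℝ)
      ≤ K' ^ 2 * Real.log (1 + x) ^ 2 * x ^ (1 / 2 : ℝ)
        + K ^ 2 * Real.log (1 + x) ^ 2 * x ^ (1 / 2 : ℝ) := by
        refine le_trans ?_ (add_le_add
          (card_filter_rpow_lt_norm_le hK'0.le (by norm_num) hnorm hx1 hq0)
          (card_filter_rpow_lt_norm_le hK.le (by linarith) ha' hx1 hq0))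
        exact_mod_cast (Finset.card_le_card hsub).trans (Finset.card_union_le _ _)
    _ = (K' ^ 2 + K ^ 2) * Real.log (1 + x) ^ 2 * x ^ (1 / 2 : ℝ) := by ring
    _ ≤ x ^ ε * δ * x ^ (1 / 2 : ℝ) := by gcongr
    _ = δ * x ^ (1 / 2 + ε) := by
        rw [Real.rpow_add hx0]
        ring
    _ ≤ δ * q := by gcongr
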